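/- Theorem 5.1. Let $A$ be an invertible real $n\times n$ matrix with $|\det A|>1$, and let $\Gamma\subset\mathbb{R}^n$ be a full rank lattice. Suppose that there exists a sublattice (subgroup) $\Lambda\subset\Gamma$ such that, with $V=\operatorname{span}_{\mathbb{R}}\Lambda$ and $d=\dim V$, $$\lim_{j\to\infty} m_d\bigl(V\cap A^{-j}(\mathbf B(0,1))\bigr)=\infty,$$ where $\mathbf B(0,1)$ is the Euclidean unit ball of $\mathbb{R}^n$ and $m_d$ denotes $d$-dimensional Lebesgue measure on the subspace $V$. Then no $(A,\Gamma)$ wavelet set exists; that is, there is no Lebesgue measurable set $W\subset\mathbb{R}^n$ such that $$\sum_{j\in\mathbb{Z}}\mathbf 1_W(A^jx)=1\qquad\text{and}\qquad \sum_{\gamma\in\Gamma}\mathbf 1_W(x+\gamma)=1\qquad\text{for a.e. }x\in\mathbb{R}^n .$$ -/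

import Mathlib

open MeasureTheory Filter Topology

open scoped ENNReal

namespace WaveletSet

/-- The linear action `x ↦ A x` of a real `n × n` matrix on Euclidean space `ℝⁿ`. -/
noncomputable def act {n : ℕ} (A : Matrix (Fin n) (Fin n) ℝ) (x : EuclideanSpace ℝ (Fin n)) :
    EuclideanSpace ℝ (Fin n) :=
  WithLp.toLp 2 (A.mulVec x.ofLp)

/-- The number (in `[0, ∞]`) of `j ∈ ℤ` with `A ^ j x ∈ U`, that is, `∑ⱼ 𝟏_U (A ^ j x)`. -/
noncomputable def dilationSum {n : ℕ} (A : Matrix (Fin n) (Fin n) ℝ)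
    (U : Set (EuclideanSpace ℝ (Fin n))) (x : EuclideanSpace ℝ (Fin n)) : ℝ≥0∞ :=
  ∑' j : ℤ, U.indicator (fun _ => (1 : ℝ≥0∞)) (act (A ^ j) x)

/-- The number (in `[0, ∞]`) of `γ ∈ Γ` with `x + γ ∈ U`, that is, `∑_γ 𝟏_U (x + γ)`. -/
noncomputable def translationSum {n : ℕ} (Γ : Submodule ℤ (EuclideanSpace ℝ (Fin n)))
    (U : Set (EuclideanSpace ℝ (Fin n))) (x : EuclideanSpace ℝ (Fin n)) : ℝ≥0∞ :=
  ∑' γ : Γ, U.indicator (fun _ => (1 : ℝ≥0∞)) (x + (γ : EuclideanSpace ℝ (Fin n)))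

/-- `U` tiles by `A` dilations: it packs (the sum is at most `1` almost everywhere) and it covers
(the sum is at least `1` almost everywhere). -/
def TilesByDilations {n : ℕ} (A : Matrix (Fin n) (Fin n) ℝ)
    (U : Set (EuclideanSpace ℝ (Fin n))) : Prop :=
  (∀ᵐ x ∂(volume : Measure (EuclideanSpace ℝ (Fin n))), dilationSum A U x ≤ 1) ∧
    (∀ᵐ x ∂(volume : Measure (EuclideanSpace ℝ (Fin n))), 1 ≤ dilationSum A U x)

/-- `U` tiles by `Γ` translations: it packs and it covers, almost everywhere. -/
def TilesByTranslations {n : ℕ} (Γ : Submodule ℤ (EuclideanSpace ℝ (Fin n)))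
    (U : Set (EuclideanSpace ℝ (Fin n))) : Prop :=
  (∀ᵐ x ∂(volume : Measure (EuclideanSpace ℝ (Fin n))), translationSum Γ U x ≤ 1) ∧
    (∀ᵐ x ∂(volume : Measure (EuclideanSpace ℝ (Fin n))), 1 ≤ translationSum Γ U x)

/-- `W` is an `(A, Γ)` wavelet set: a Lebesgue measurable set that tiles `ℝⁿ` both by
`A` dilations and by `Γ` translations. -/
structure IsWaveletSet {n : ℕ} (A : Matrix (Fin n) (Fin n) ℝ)
    (Γ : Submodule ℤ (EuclideanSpace ℝ (Fin n))) (W : Set (EuclideanSpace ℝ (Fin n))) : Prop where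
  lebesgueMeasurable : NullMeasurableSet W (volume : Measure (EuclideanSpace ℝ (Fin n)))
  tilesByDilations : TilesByDilations A W
  tilesByTranslations : TilesByTranslations Γ W

/-- `d`-dimensional Lebesgue measure on a subspace `V` of `ℝⁿ`, `d = dim V`: the volume of `V` as
a Euclidean space, for which the parallelepiped of an orthonormal basis of `V` has measure `1`.
The instance is given explicitly because the volume of a subtype could also mean the restriction
of the ambient `n`-dimensional measure. -/
noncomputable def subspaceVolume {n : ℕ} (V : Submodule ℝ (EuclideanSpace ℝ (Fin n))) :
    Measure V :=
  @volume V measureSpaceOfInnerProductSpace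

/-- The measure `m_d (V ∩ S)`, `d = dim V`, of the part of `S ⊆ ℝⁿ` that lies in `V`. -/
noncomputable def sectionVolume {n : ℕ} (V : Submodule ℝ (EuclideanSpace ℝ (Fin n)))
    (S : Set (EuclideanSpace ℝ (Fin n))) : ℝ≥0∞ :=
  subspaceVolume V {v : V | (v : EuclideanSpace ℝ (Fin n)) ∈ S}

end WaveletSet

/-! Suppose `W` is a wavelet set. Its dilates cover the ball of radius `R`, of volume `c * R ^ n`.
The sets `A ^ (-k) W`, `k ≥ 0`, have bounded total volume, since `|det A| > 1` and `W` has finite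
volume. On `V`, `A ^ k` is an isometry after an endomorphism `N k`. The set `A ^ k W` packs by the
`A ^ k` image of a lattice spanning `V`, and along that image a set of volume `O(|det (N k)| * R ^
(n - d))` covers the ball, so `A ^ k W` fills at most that much of it (`measure_inter_le_of_packs`,
`exists_covering_set`). If `∑ |det (N k)|` converges, large `R` gives a contradiction, as `d > 0`.

The hypothesis only says that `det (N k)` tends to zero. But `|det (N k)|` is comparable to the norm
of the wedge of the vectors `A ^ k bᵢ` (`exists_norm_apply_comparable_det`), which is an orbit of a
linear map in finite dimension; such an orbit, once it tends to zero, is summable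
(`summable_norm_pow_apply`). -/

namespace WaveletSet

/-! ### Orbits of linear maps that tend to zero -/

/-- An orbit of a linear map of a finite-dimensional space that tends to zero is summable. -/
theorem summable_norm_pow_apply {Y : Type*} [NormedAddCommGroup Y] [NormedSpace ℝ Y]
    [FiniteDimensional ℝ Y] (S : Y →L[ℝ] Y) (y : Y)
    (h : Tendsto (fun j : ℕ => (S ^ j) y) atTop (𝓝 0)) :
    Summable fun j : ℕ => ‖(S ^ j) y‖ := by
  -- The stable subspace: `S` may expand elsewhere, but smallness on a basis of `F` makes some power
  -- contract all of `F`.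
  let F : Submodule ℝ Y :=
    { carrier := {w | Tendsto (fun j : ℕ => (S ^ j) w) atTop (𝓝 0)}
      add_mem' := fun {a b} ha hb => by simpa using Tendsto.add ha hb
      zero_mem' := by simp
      smul_mem' := fun c a ha => by
        simpa only [Set.mem_ofPred_eq, map_smul, smul_zero] using Tendsto.const_smul ha c }
  let b := Module.finBasis ℝ F
  obtain ⟨C, hC, hb⟩ := b.exists_opNorm_le (F := Y)
  have hev : ∀ᶠ k : ℕ in atTop, ∀ i, ‖(S ^ k) (b i : Y)‖ ≤ (2 * C)⁻¹ := by
    rw [eventually_all]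
    intro i
    have h1 : Tendsto (fun k : ℕ => ‖(S ^ k) (b i : Y)‖) atTop (𝓝 0) := by
      simpa using Tendsto.norm (b i).2
    exact h1.eventually_le_const (by positivity)
  obtain ⟨k, hk⟩ := hev.exists
  have hop : ‖(S ^ k).comp F.subtypeL‖ ≤ 1 / 2 := by
    have := hb (u := (S ^ k).comp F.subtypeL) (M := (2 * C)⁻¹) (by positivity) (by simpa using hk)
    refine this.trans (le_of_eq ?_)
    field_simp
  have hstep : ∀ j : ℕ, ‖(S ^ (k + j)) y‖ ≤ 1 / 2 * ‖(S ^ j) y‖ := by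
    intro j
    have hmem : (S ^ j) y ∈ F := by
      change Tendsto (fun i : ℕ => (S ^ i) ((S ^ j) y)) atTop (𝓝 0)
      have := h.comp (tendsto_add_atTop_nat j)
      refine this.congr fun i => ?_
      rw [Function.comp_apply, pow_add]; rfl
    have := ((S ^ k).comp F.subtypeL).le_of_opNorm_le hop ⟨_, hmem⟩
    rw [pow_add]
    exact this
  -- The first `k` terms plus half of the partial sum bound the partial sum, whence the factor `2`.
  refine summable_of_sum_range_le (c := 2 * ∑ i ∈ Finset.range k, ‖(S ^ i) y‖)
    (fun _ => norm_nonneg _) fun m => ?_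
  have h1 : ∑ i ∈ Finset.range m, ‖(S ^ i) y‖ ≤ ∑ i ∈ Finset.range (k + m), ‖(S ^ i) y‖ :=
    Finset.sum_le_sum_of_subset_of_nonneg (Finset.range_mono (by omega))
      fun _ _ _ => norm_nonneg _
  rw [Finset.sum_range_add] at h1
  have h2 : ∑ i ∈ Finset.range m, ‖(S ^ (k + i)) y‖
      ≤ 1 / 2 * ∑ i ∈ Finset.range m, ‖(S ^ i) y‖ := by
    rw [Finset.mul_sum]
    exact Finset.sum_le_sum fun i _ => hstep i
  linarith

theorem summable_norm_of_linear_recurrence {Y : Type*} [NormedAddCommGroup Y] [NormedSpace ℝ Y]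
    [FiniteDimensional ℝ Y] (S : Y →L[ℝ] Y) (φ : ℕ → Y) (hφ : ∀ j, φ (j + 1) = S (φ j))
    (h : Tendsto φ atTop (𝓝 0)) : Summable fun j : ℕ => ‖φ j‖ := by
  have key : ∀ j : ℕ, φ j = (S ^ j) (φ 0) := by
    intro j
    induction j with
    | zero => simp
    | succ j ih => rw [hφ, ih, pow_succ']; rfl
  have h' : Tendsto (fun j : ℕ => (S ^ j) (φ 0)) atTop (𝓝 0) := h.congr key
  exact (summable_norm_pow_apply S (φ 0) h').congr fun j => by rw [key j]

/-- Precomposition with `T` is a linear map of the finite-dimensional dual, and `φ` is an orbit of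
it. -/
theorem summable_norm_of_dual_recurrence {X : Type*} [NormedAddCommGroup X] [NormedSpace ℝ X]
    [FiniteDimensional ℝ X] (T : X →L[ℝ] X) (φ : ℕ → X →L[ℝ] ℝ)
    (hφ : ∀ j ω, φ (j + 1) ω = φ j (T ω)) {a : ℕ → ℝ} (hle : ∀ j, ‖φ j‖ ≤ a j)
    (ha : Tendsto a atTop (𝓝 0)) : Summable fun j : ℕ => ‖φ j‖ :=
  summable_norm_of_linear_recurrence (ContinuousLinearMap.precomp ℝ T) φ
    (fun j => ContinuousLinearMap.ext fun ω => hφ j ω) (squeeze_zero_norm hle ha)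

/-! ### Wedge products and determinants on a subspace -/

section InnerProduct

variable {E : Type*} [NormedAddCommGroup E] [InnerProductSpace ℝ E] [FiniteDimensional ℝ E]
variable {ι : Type*} [Fintype ι]

instance finiteDimensional_continuousAlternatingMap : FiniteDimensional ℝ (E [⋀^ι]→L[ℝ] ℝ) :=
  Module.Finite.of_injective
    (N := MultilinearMap ℝ (fun _ : ι => E) ℝ)
    ({ toFun := fun f => f.toMultilinearMap
       map_add' := fun _ _ => rfl
       map_smul' := fun _ _ => rfl } :
      (E [⋀^ι]→L[ℝ] ℝ) →ₗ[ℝ] MultilinearMap ℝ (fun _ : ι => E) ℝ)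
    (fun f g h => by
      ext v
      exact congrArg (fun m : MultilinearMap ℝ (fun _ : ι => E) ℝ => m v) h)

/-- If the wedge product of the vectors `A ^ j vᵢ`, as a functional on alternating forms, tends
to zero, then its norms are summable. -/
theorem summable_norm_apply_pow (A : E →L[ℝ] E) (v : ι → E)
    {a : ℕ → ℝ}
    (hle : ∀ j, ‖ContinuousAlternatingMap.apply ℝ E ℝ (fun i => (A ^ j) (v i))‖ ≤ a j)
    (ha : Tendsto a atTop (𝓝 0)) :
    Summable fun j : ℕ => ‖ContinuousAlternatingMap.apply ℝ E ℝ (fun i => (A ^ j) (v i))‖ := by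
  refine summable_norm_of_dual_recurrence
    (ContinuousAlternatingMap.compContinuousLinearMapCLM A) _ (fun j ω => ?_) hle ha
  change ω (fun i => (A ^ (j + 1)) (v i)) = ω (fun i => A ((A ^ j) (v i)))
  simp only [pow_succ']
  rfl

/-- An injective linear map on a subspace is an endomorphism of the subspace followed by an
isometry of the ambient space. -/
theorem exists_isometry_comp_endomorphism (V : Submodule ℝ E) (g : E →ₗ[ℝ] E)
    (hg : Function.Injective g) :
    ∃ (F : E ≃ₗᵢ[ℝ] E) (N : V →ₗ[ℝ] V), LinearMap.det N ≠ 0 ∧ ∀ v : V, g v = F (N v) := by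
  let U := V.map g
  let e₀ : V ≃ₗ[ℝ] U := Submodule.equivMapOfInjective g hg V
  let e : V ≃ₗᵢ[ℝ] U := (stdOrthonormalBasis ℝ V).repr.trans
    ((stdOrthonormalBasis ℝ U).reindex (finCongr e₀.finrank_eq.symm)).repr.symm
  let F := (U.subtypeₗᵢ.comp e.toLinearIsometry).extend.toLinearIsometryEquiv rfl
  refine ⟨F, (e₀.trans e.symm.toLinearEquiv : V ≃ₗ[ℝ] V), ?_, fun v => ?_⟩
  · exact (LinearEquiv.isUnit_det' _).ne_zero
  · have : g v = e₀ v := rfl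
    simp [F, LinearIsometry.extend_apply, this]

/-- The functional on alternating forms given by the image of a basis of `V` under an isometry
after an endomorphism `N` of `V` is comparable to `det N`. -/
theorem exists_norm_apply_comparable_det (V : Submodule ℝ E) (b : Module.Basis ι ℝ V) :
    ∃ C : ℝ, ∀ (F : E ≃ₗᵢ[ℝ] E) (N : V →ₗ[ℝ] V),
      ‖ContinuousAlternatingMap.apply ℝ E ℝ (fun i => F (N (b i)))‖ ≤ C * |LinearMap.det N| ∧
      |LinearMap.det N| ≤
        C * ‖ContinuousAlternatingMap.apply ℝ E ℝ (fun i => F (N (b i)))‖ := by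
  classical
  have hcont : Continuous b.det := by
    have : ⇑b.det = fun v : ι → V => (b.toMatrix v).det := by
      ext v; exact b.det_apply v
    rw [this]
    refine Continuous.matrix_det (continuous_matrix fun i j => ?_)
    exact (b.coord i).continuous_of_finiteDimensional.comp (continuous_apply j)
  let D : V [⋀^ι]→L[ℝ] ℝ := { b.det with cont := hcont }
  have hD : ∀ v, D v = b.det v := fun _ => rfl
  refine ⟨max (∏ i, ‖(b i : E)‖) ‖D‖, fun F N => ⟨?_, ?_⟩⟩
  · refine le_trans ?_ (mul_le_mul_of_nonneg_right (le_max_left _ _) (abs_nonneg _))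
    refine ContinuousLinearMap.opNorm_le_bound _ (by positivity) fun ω => ?_
    -- A form of top degree on `V`, so substituting `N` multiplies it by `det N`.
    let ω' : V [⋀^ι]→ₗ[ℝ] ℝ :=
      ω.toAlternatingMap.compLinearMap (F.toLinearEquiv.toLinearMap ∘ₗ V.subtype)
    have h1 : ω (fun i => F (N (b i))) = ω' b * LinearMap.det N := by
      have h2 : ω (fun i => F (N (b i))) = ω' (N ∘ b) := rfl
      rw [h2, ω'.eq_smul_basis_det b]
      simp [Module.Basis.det_comp, b.det_self]
    have h3 : ‖ω' b‖ ≤ ‖ω‖ * ∏ i, ‖(b i : E)‖ := by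
      have := ω.le_opNorm (fun i => F (b i : E))
      simp only [LinearIsometryEquiv.norm_map] at this
      exact this
    rw [ContinuousAlternatingMap.apply_apply, h1, norm_mul, Real.norm_eq_abs (LinearMap.det N)]
    calc _ ≤ (‖ω‖ * ∏ i, ‖(b i : E)‖) * |LinearMap.det N| := by gcongr
      _ = _ := by ring
  · refine le_trans ?_ (mul_le_mul_of_nonneg_right (le_max_right _ _) (by positivity))
    -- Test the functional on `b.det` pulled back by a norm-one-bounded map that undoes `F` on `V`.
    let P : E →L[ℝ] V := V.orthogonalProjectionOnto ∘L
      (F.symm.toContinuousLinearEquiv : E →L[ℝ] E)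
    have hP : ‖P‖ ≤ 1 := by
      refine ContinuousLinearMap.opNorm_le_bound _ zero_le_one fun x => ?_
      have := V.norm_orthogonalProjectionOnto_apply_le (F.symm x)
      simpa [P] using this
    have h1 := (ContinuousAlternatingMap.apply ℝ E ℝ (fun i => F (N (b i)))).le_opNorm
      (D.compContinuousLinearMap P)
    have h2 : ContinuousAlternatingMap.apply ℝ E ℝ (fun i => F (N (b i)))
        (D.compContinuousLinearMap P) = LinearMap.det N := by
      have : (D.compContinuousLinearMap P) (fun i => F (N (b i))) = D (N ∘ b) := by
        simp [P, Function.comp_def]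
      rw [ContinuousAlternatingMap.apply_apply, this, hD, Module.Basis.det_comp, b.det_self, mul_one]
    have h3 : ‖D.compContinuousLinearMap P‖ ≤ ‖D‖ := by
      refine (D.norm_compContinuousLinearMap_le P).trans ?_
      exact mul_le_of_le_one_right (norm_nonneg _) (pow_le_one₀ (norm_nonneg _) hP)
    rw [h2] at h1
    calc _ ≤ _ := h1
      _ ≤ ‖ContinuousAlternatingMap.apply ℝ E ℝ (fun i => F (N (b i)))‖ * ‖D‖ := by gcongr
      _ = _ := mul_comm _ _

end InnerProduct

/-! ### Packing, covering and volume -/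

/-- A set that packs by countably many translations has, within a set covered by the translates
of `Q`, at most the measure of `Q`. -/
theorem measure_inter_le_of_packs {E κ : Type*} [AddCommGroup E] [MeasurableSpace E]
    [MeasurableAdd E] [Countable κ] (μ : Measure E) [μ.IsAddRightInvariant] (τ : κ → E)
    {S B Q : Set E} (hS : NullMeasurableSet S μ)
    (hpack : ∀ᵐ x ∂μ, ∑' k, S.indicator (fun _ => (1 : ℝ≥0∞)) (x + τ k) ≤ 1)
    (hcov : ∀ x ∈ B, ∃ k, x - τ k ∈ Q) : μ (S ∩ B) ≤ μ Q := by
  have hpre : ∀ k, NullMeasurableSet ((fun x => x + τ k) ⁻¹' S) μ := fun k =>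
    hS.preimage (measurePreserving_add_right μ (τ k)).quasiMeasurePreserving
  calc μ (S ∩ B) ≤ μ (⋃ k, S ∩ (fun x => x - τ k) ⁻¹' Q) := by
        refine measure_mono fun x hx => ?_
        obtain ⟨k, hk⟩ := hcov x hx.2
        exact Set.mem_iUnion.2 ⟨k, hx.1, hk⟩
    _ ≤ ∑' k, μ (S ∩ (fun x => x - τ k) ⁻¹' Q) := measure_iUnion_le _
    _ = ∑' k, ∫⁻ x in Q, S.indicator (fun _ => (1 : ℝ≥0∞)) (x + τ k) ∂μ := by
        congr 1; ext k
        have h1 : (fun x => S.indicator (fun _ => (1 : ℝ≥0∞)) (x + τ k))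
            = ((fun x => x + τ k) ⁻¹' S).indicator 1 := rfl
        rw [h1, lintegral_indicator_one₀ ((hpre k).mono_ac Measure.absolutelyContinuous_restrict),
          Measure.restrict_apply₀ ((hpre k).mono_ac Measure.absolutelyContinuous_restrict),
          ← measure_preimage_add_right μ (τ k)]
        congr 1
        ext x
        simp
    _ = ∫⁻ x in Q, ∑' k, S.indicator (fun _ => (1 : ℝ≥0∞)) (x + τ k) ∂μ := by
        rw [lintegral_tsum]
        intro k
        exact (aemeasurable_indicator_const_iff (1 : ℝ≥0∞)).2
          ((hpre k).mono_ac Measure.absolutelyContinuous_restrict)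
    _ ≤ ∫⁻ _ in Q, 1 ∂μ := lintegral_mono_ae (ae_restrict_of_ae hpack)
    _ = μ Q := by simp

/-- If the volume of the preimages of the unit ball under the linear maps `N j` tends to infinity,
then their determinants tend to zero. -/
theorem tendsto_abs_det_zero {V : Type*} [NormedAddCommGroup V] [NormedSpace ℝ V]
    [FiniteDimensional ℝ V] [MeasurableSpace V] [BorelSpace V] (μ : Measure V)
    [μ.IsAddHaarMeasure] (N : ℕ → V →ₗ[ℝ] V) (hN : ∀ j, LinearMap.det (N j) ≠ 0)
    (h : Tendsto (fun j => μ {v | ‖N j v‖ < 1}) atTop (𝓝 ∞)) :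
    Tendsto (fun j => |LinearMap.det (N j)|) atTop (𝓝 0) := by
  have hβ : μ (Metric.ball 0 1) ≠ ∞ := measure_ball_lt_top.ne
  have h1 : ∀ j, μ {v | ‖N j v‖ < 1}
      = ENNReal.ofReal |(LinearMap.det (N j))⁻¹| * μ (Metric.ball 0 1) := by
    intro j
    rw [← Measure.addHaar_preimage_linearMap μ (hN j)]
    congr 1; ext v; simp
  simp_rw [h1] at h
  have h2 : Tendsto (fun j => |LinearMap.det (N j)|⁻¹) atTop atTop := by
    rw [tendsto_atTop]
    intro c
    have h3 : ENNReal.ofReal c * μ (Metric.ball 0 1) < ∞ :=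
      ENNReal.mul_lt_top ENNReal.ofReal_lt_top hβ.lt_top
    filter_upwards [h.eventually (lt_mem_nhds h3)] with j hj
    by_contra! hc
    refine absurd hj (not_lt.2 ?_)
    rw [abs_inv]
    gcongr
  exact (h2.inv_tendsto_atTop).congr fun j => inv_inv _

section InnerProduct

variable {E : Type*} [NormedAddCommGroup E] [InnerProductSpace ℝ E] [FiniteDimensional ℝ E]
variable {ι : Type*} [Fintype ι]

/-- Every ball of radius `R` is covered by translates, along the image under `F ∘ N` of the lattice
spanned by a basis of `V`, of a set whose volume is at most a multiple of
`|det N| * R ^ dim Vᗮ`. -/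
theorem exists_covering_set [MeasurableSpace E] [BorelSpace E] (μ : Measure E)
    [μ.IsAddHaarMeasure] (V : Submodule ℝ E) (b : Module.Basis ι ℝ V) :
    ∃ K : ℝ, 0 ≤ K ∧ ∀ (F : E ≃ₗᵢ[ℝ] E) (N : V →ₗ[ℝ] V), LinearMap.det N ≠ 0 → ∀ R : ℝ, 0 < R →
      ∃ Q : Set E, μ Q ≤ ENNReal.ofReal (|LinearMap.det N| * R ^ Module.finrank ℝ Vᗮ * K) ∧
        ∀ x ∈ Metric.ball (0 : E) R, ∃ γ : Submodule.span ℤ (Set.range b),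
          x - F (N (γ : V)) ∈ Q := by
  let e := V.prodEquivOfIsCompl Vᗮ V.isCompl_orthogonal
  let Q₁ : Set E := e '' (ZSpan.fundamentalDomain b ×ˢ Metric.closedBall 0 1)
  have hQ₁ : μ Q₁ ≠ ∞ := by
    obtain ⟨c, hc⟩ := isBounded_iff_forall_norm_le.1 (ZSpan.fundamentalDomain_isBounded b)
    have hb : Bornology.IsBounded Q₁ := by
      refine isBounded_iff_forall_norm_le.2 ⟨c + 1, ?_⟩
      rintro _ ⟨⟨p, u⟩, ⟨hp, hu⟩, rfl⟩
      refine (norm_add_le (p : E) (u : E)).trans (add_le_add (hc p hp) ?_)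
      simpa using hu
    exact hb.measure_lt_top.ne
  refine ⟨(μ Q₁).toReal, ENNReal.toReal_nonneg, fun F N hN R hR => ?_⟩
  -- `N` along `V` and dilation by `R` along `Vᗮ`: this gives the factor `R ^ dim Vᗮ`.
  let G : E →ₗ[ℝ] E := e.conj (N.prodMap (R • LinearMap.id))
  have hG : LinearMap.det (F.toLinearEquiv.toLinearMap ∘ₗ G)
      = LinearMap.det F.toLinearEquiv.toLinearMap *
        (LinearMap.det N * R ^ Module.finrank ℝ Vᗮ) := by
    rw [LinearMap.det_comp]
    congr 1
    change LinearMap.det (e.conj (N.prodMap (R • LinearMap.id))) = _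
    rw [LinearEquiv.conj_apply, LinearMap.comp_assoc, LinearMap.det_conj, LinearMap.det_prodMap]
    simp
  have hF : |LinearMap.det F.toLinearEquiv.toLinearMap| = 1 := by
    rw [← LinearMap.normDet_eq_abs_det]
    exact F.toLinearIsometry.normDet_eq_one
  refine ⟨(F.toLinearEquiv.toLinearMap ∘ₗ G) '' Q₁, le_of_eq ?_, fun x hx => ?_⟩
  · rw [Measure.addHaar_image_linearMap, hG, abs_mul, hF, one_mul, abs_mul,
      abs_of_pos (pow_pos hR _), ENNReal.ofReal_mul (by positivity : 0 ≤ |LinearMap.det N| * _),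
      ENNReal.ofReal_toReal hQ₁]
  · obtain ⟨⟨p, u⟩, hpu⟩ := e.surjective (F.symm x)
    obtain ⟨p', rfl⟩ := (LinearMap.equivOfDetNeZero N hN).surjective p
    have hpu' : (N p' : E) + (u : E) = F.symm x := hpu
    have hu : ‖u‖ ≤ R := by
      have h1 : u = Vᗮ.orthogonalProjectionOnto (F.symm x) := by
        have h0 : Vᗮ.orthogonalProjectionOnto (N p' : E) = 0 :=
          Submodule.orthogonalProjectionOnto_orthogonal_apply_eq_zero (N p').2
        rw [← hpu', map_add, Submodule.orthogonalProjectionOnto_mem_subspace_eq_self, h0, zero_add]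
      rw [h1]
      refine (Vᗮ.norm_orthogonalProjectionOnto_apply_le _).trans ?_
      rw [F.symm.norm_map]
      exact (mem_ball_zero_iff.1 hx).le
    refine ⟨ZSpan.floor b p', _, ⟨(ZSpan.fract b p', R⁻¹ • u),
      ⟨ZSpan.fract_mem_fundamentalDomain b p', ?_⟩, rfl⟩, ?_⟩
    · rw [mem_closedBall_zero_iff, norm_smul, norm_inv, Real.norm_of_nonneg hR.le]
      exact inv_mul_le_one_of_le₀ hu hR.le
    · have hx' : x = F ((N p' : E) + (u : E)) := by rw [hpu', F.apply_symm_apply]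
      have h2 : G (e (ZSpan.fract b p', R⁻¹ • u)) = (N (ZSpan.fract b p') : E) + u := by
        simp [G, e, LinearEquiv.conj_apply, smul_smul, hR.ne']
      change F (G (e (ZSpan.fract b p', R⁻¹ • u))) = _
      rw [h2, hx', ZSpan.fract_apply, ← map_sub]
      congr 1
      simp only [map_sub, Submodule.coe_sub]
      abel

end InnerProduct

/-- A basis can be chosen inside the spanning set `Λ`. It may generate a proper subgroup, which
suffices for packing. -/
theorem exists_basis_span_mem {E : Type*} [NormedAddCommGroup E] [NormedSpace ℝ E]
    [FiniteDimensional ℝ E] (Λ : Submodule ℤ E) :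
    ∃ (ι : Set E) (_ : Fintype ι) (b : Module.Basis ι ℝ (Submodule.span ℝ (Λ : Set E))),
      ∀ γ ∈ Submodule.span ℤ (Set.range b), (γ : E) ∈ Λ := by
  obtain ⟨t, ht, hspan, hli⟩ := exists_linearIndependent ℝ (Λ : Set E)
  have : Finite t := hli.finite
  have := Fintype.ofFinite t
  have hV : Submodule.span ℝ (Set.range (Subtype.val : t → E)) = Submodule.span ℝ (Λ : Set E) := by
    rw [Subtype.range_coe, hspan]
  let b := (Module.Basis.span hli).map (LinearEquiv.ofEq _ _ hV)
  have hb : ∀ i, (b i : E) = i := fun i => by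
    simp [b, Module.Basis.span_apply]
  refine ⟨t, this, b, fun γ hγ => ?_⟩
  induction hγ using Submodule.span_induction with
  | mem x hx =>
    obtain ⟨i, rfl⟩ := hx
    rw [hb]
    exact ht i.2
  | zero => exact Λ.zero_mem
  | add x y _ _ hx hy => exact Λ.add_mem hx hy
  | smul a x _ hx => exact Λ.smul_mem a hx

/-! ### The matrix action and the dilates of a packing set -/

variable {n : ℕ}

theorem act_mul (A B : Matrix (Fin n) (Fin n) ℝ) (x : EuclideanSpace ℝ (Fin n)) :
    act (A * B) x = act A (act B x) := by
  simp [act, Matrix.mulVec_mulVec]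

theorem act_one (x : EuclideanSpace ℝ (Fin n)) : act 1 x = x := by
  simp [act]

theorem act_zpow_neg_act_pow {A : Matrix (Fin n) (Fin n) ℝ} (hA : A.det ≠ 0) (j : ℕ)
    (x : EuclideanSpace ℝ (Fin n)) : act (A ^ (-(j : ℤ))) (act (A ^ j) x) = x := by
  rw [← act_mul, Matrix.zpow_neg_natCast, Matrix.nonsing_inv_mul, act_one]
  rw [Matrix.det_pow]
  exact (pow_ne_zero j hA).isUnit

theorem act_pow_act_zpow_neg {A : Matrix (Fin n) (Fin n) ℝ} (hA : A.det ≠ 0) (j : ℕ)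
    (x : EuclideanSpace ℝ (Fin n)) : act (A ^ j) (act (A ^ (-(j : ℤ))) x) = x := by
  rw [← act_mul, Matrix.zpow_neg_natCast, Matrix.mul_nonsing_inv, act_one]
  rw [Matrix.det_pow]
  exact (pow_ne_zero j hA).isUnit

theorem act_pow_eq (A : Matrix (Fin n) (Fin n) ℝ) (j : ℕ) (x : EuclideanSpace ℝ (Fin n)) :
    act (A ^ j) x = (Matrix.toEuclideanCLM (𝕜 := ℝ) A ^ j) x := by
  rw [← map_pow]
  rfl

theorem volume_preimage_act {B : Matrix (Fin n) (Fin n) ℝ} (hB : B.det ≠ 0)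
    (W : Set (EuclideanSpace ℝ (Fin n))) :
    volume {x | act B x ∈ W} = ENNReal.ofReal |B.det|⁻¹ * volume W := by
  have hdet : LinearMap.det (Matrix.toEuclideanLin B) = B.det := LinearMap.det_toLpLin 2 B
  have := Measure.addHaar_preimage_linearMap volume (hdet ▸ hB) W
  rw [hdet, abs_inv] at this
  exact this

theorem quasiMeasurePreserving_act {B : Matrix (Fin n) (Fin n) ℝ} (hB : B.det ≠ 0) :
    Measure.QuasiMeasurePreserving (act B) volume volume := by
  have hdet : LinearMap.det (Matrix.toEuclideanLin B) = B.det := LinearMap.det_toLpLin 2 B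
  exact Measure.LinearMap.quasiMeasurePreserving volume (Matrix.toEuclideanLin B) (hdet ▸ hB)

theorem volume_ne_top_of_packs (Γ : Submodule ℤ (EuclideanSpace ℝ (Fin n))) [DiscreteTopology Γ]
    [IsZLattice ℝ Γ] {W : Set (EuclideanSpace ℝ (Fin n))} (hW : NullMeasurableSet W volume)
    (hpack : ∀ᵐ x, translationSum Γ W x ≤ 1) : volume W ≠ ∞ := by
  let b := (Module.Free.chooseBasis ℤ Γ).ofZLatticeBasis ℝ Γ
  have hb : Submodule.span ℤ (Set.range b) = Γ :=
    (Module.Free.chooseBasis ℤ Γ).ofZLatticeBasis_span ℝ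
  have h := measure_inter_le_of_packs volume (fun γ : Γ => (γ : EuclideanSpace ℝ (Fin n)))
    (B := Set.univ) (Q := ZSpan.fundamentalDomain b) hW hpack fun x _ =>
      ⟨⟨ZSpan.floor b x, hb.le (ZSpan.floor b x).2⟩, ZSpan.fract_mem_fundamentalDomain b x⟩
  rw [Set.inter_univ] at h
  exact ne_top_of_le_ne_top (ZSpan.fundamentalDomain_isBounded b).measure_lt_top.ne h

/-- The dilate `A ^ j W` of a set packing by `Γ` packs by the image under `A ^ j` of a part
of `Γ`. -/
theorem packs_dilate {A : Matrix (Fin n) (Fin n) ℝ} (hA : A.det ≠ 0)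
    (Γ : Submodule ℤ (EuclideanSpace ℝ (Fin n))) {W : Set (EuclideanSpace ℝ (Fin n))}
    (hpack : ∀ᵐ x, translationSum Γ W x ≤ 1) {κ : Type*} (f : κ → Γ)
    (hf : Function.Injective f) (j : ℕ) :
    ∀ᵐ x, ∑' k, {x | act (A ^ (-(j : ℤ))) x ∈ W}.indicator (fun _ => (1 : ℝ≥0∞))
      (x + act (A ^ j) (f k : EuclideanSpace ℝ (Fin n))) ≤ 1 := by
  have hdet : (A ^ (-(j : ℤ))).det ≠ 0 := by
    rw [Matrix.zpow_neg_natCast, Matrix.det_nonsing_inv, Matrix.det_pow]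
    simp [hA]
  filter_upwards [(quasiMeasurePreserving_act hdet).ae hpack] with x hx
  refine le_trans ?_ hx
  refine le_trans (le_of_eq ?_) (ENNReal.tsum_comp_le_tsum_of_injective hf _)
  refine tsum_congr fun k => ?_
  have : act (A ^ (-(j : ℤ))) (x + act (A ^ j) (f k : EuclideanSpace ℝ (Fin n)))
      = act (A ^ (-(j : ℤ))) x + f k := by
    have hadd : ∀ y z, act (A ^ (-(j : ℤ))) (y + z)
        = act (A ^ (-(j : ℤ))) y + act (A ^ (-(j : ℤ))) z :=
      map_add (Matrix.toEuclideanLin (A ^ (-(j : ℤ))))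
    rw [hadd, act_zpow_neg_act_pow hA]
  rw [← this]
  rfl

theorem sectionVolume_image_act {A : Matrix (Fin n) (Fin n) ℝ} (hA : A.det ≠ 0)
    (V : Submodule ℝ (EuclideanSpace ℝ (Fin n))) (j : ℕ) :
    sectionVolume V (act (A ^ (-(j : ℤ))) '' Metric.ball 0 1)
      = subspaceVolume V {v : V | ‖act (A ^ j) v‖ < 1} := by
  unfold sectionVolume
  congr 1; ext v
  constructor
  · rintro ⟨y, hy, hv⟩
    have : act (A ^ j) (v : EuclideanSpace ℝ (Fin n)) = y := by
      rw [← hv, act_pow_act_zpow_neg hA]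
    simpa [this] using hy
  · intro hv
    exact ⟨_, mem_ball_zero_iff.2 hv, act_zpow_neg_act_pow hA j _⟩

theorem injective_toEuclideanLin_pow {A : Matrix (Fin n) (Fin n) ℝ} (hA : A.det ≠ 0) (j : ℕ) :
    Function.Injective (Matrix.toEuclideanLin (A ^ j)) :=
  Function.LeftInverse.injective (g := act (A ^ (-(j : ℤ)))) (act_zpow_neg_act_pow hA j)

/-- The restrictions to `V` of the powers of `A` are isometries after endomorphisms of `V`, and
if the volume of the sections tends to infinity, then the determinants of these endomorphisms are
summable, and `V` is not zero. -/
theorem exists_factorization_summable {A : Matrix (Fin n) (Fin n) ℝ} (hA : A.det ≠ 0)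
    (V : Submodule ℝ (EuclideanSpace ℝ (Fin n))) {ι : Type*} [Fintype ι]
    (b : Module.Basis ι ℝ V)
    (h : Tendsto (fun j : ℕ => sectionVolume V (act (A ^ (-(j : ℤ))) '' Metric.ball 0 1))
        atTop (𝓝 ∞)) :
    ∃ (F : ℕ → EuclideanSpace ℝ (Fin n) ≃ₗᵢ[ℝ] EuclideanSpace ℝ (Fin n)) (N : ℕ → V →ₗ[ℝ] V),
      (∀ j, LinearMap.det (N j) ≠ 0) ∧ (∀ j (v : V), act (A ^ j) v = F j (N j v)) ∧
      Summable (fun j => |LinearMap.det (N j)|) ∧ 0 < Module.finrank ℝ V := by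
  choose F N hN hFN using fun j => exists_isometry_comp_endomorphism V
    (Matrix.toEuclideanLin (A ^ j)) (injective_toEuclideanLin_pow hA j)
  have hFN' : ∀ j (v : V), act (A ^ j) v = F j (N j v) := hFN
  have : (subspaceVolume V).IsAddHaarMeasure :=
    isAddHaarMeasure_basis_addHaar (stdOrthonormalBasis ℝ V).toBasis
  have hdet : Tendsto (fun j => |LinearMap.det (N j)|) atTop (𝓝 0) := by
    refine tendsto_abs_det_zero (subspaceVolume V) N hN (h.congr fun j => ?_)
    rw [sectionVolume_image_act hA]
    simp [hFN']
  obtain ⟨C, hC⟩ := exists_norm_apply_comparable_det V b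
  have hφ : ∀ j, (fun i => F j (N j (b i)))
      = fun i => (Matrix.toEuclideanCLM (𝕜 := ℝ) A ^ j) (b i : EuclideanSpace ℝ (Fin n)) := by
    intro j; ext1 i
    rw [← hFN', act_pow_eq]
  have hsum := summable_norm_apply_pow (Matrix.toEuclideanCLM (𝕜 := ℝ) A)
    (fun i => (b i : EuclideanSpace ℝ (Fin n))) (a := fun j => C * |LinearMap.det (N j)|)
    (fun j => hφ j ▸ (hC (F j) (N j)).1) (by simpa using hdet.const_mul C)
  refine ⟨F, N, hN, hFN', ?_, ?_⟩
  · refine Summable.of_nonneg_of_le (fun _ => abs_nonneg _) (fun j => ?_) (hsum.mul_left C)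
    rw [← hφ]
    exact (hC (F j) (N j)).2
  -- On the zero space every determinant is `1`, which does not tend to zero.
  · by_contra h0
    have h1 : ∀ j, |LinearMap.det (N j)| = 1 := fun j => by
      rw [LinearMap.det_eq_one_of_finrank_eq_zero (by omega), abs_one]
    simp_rw [h1] at hdet
    exact one_ne_zero (tendsto_nhds_unique tendsto_const_nhds hdet)

theorem exists_int_act_mem {A : Matrix (Fin n) (Fin n) ℝ} {W : Set (EuclideanSpace ℝ (Fin n))}
    {x : EuclideanSpace ℝ (Fin n)} (h : 1 ≤ dilationSum A W x) : ∃ j : ℤ, act (A ^ j) x ∈ W := by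
  by_contra! hx
  simp [dilationSum, hx] at h

theorem exists_real_pow_gt {β C D : ℝ} (hβ : 0 < β) (hC : 0 ≤ C) (hD : 0 ≤ D) {m n : ℕ}
    (hmn : m < n) : ∃ R : ℝ, 0 < R ∧ C + R ^ m * D < R ^ n * β := by
  have hR : 1 ≤ (C + D) / β + 1 := by
    have : 0 ≤ (C + D) / β := by positivity
    linarith
  -- Chosen so that `R * β = C + D + β` and `R ≥ 1`.
  refine ⟨(C + D) / β + 1, by positivity, ?_⟩
  generalize hRdef : (C + D) / β + 1 = R at hR
  have h1 : R * β = C + D + β := by rw [← hRdef]; field_simp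
  have h2 : 1 ≤ R ^ m := one_le_pow₀ hR
  calc C + R ^ m * D ≤ R ^ m * C + R ^ m * D := by
        gcongr
        exact le_mul_of_one_le_left hC h2
    _ < R ^ m * (C + D + β) := by nlinarith
    _ = R ^ (m + 1) * β := by rw [← h1]; ring
    _ ≤ R ^ n * β := by gcongr; exact hmn

end WaveletSet

/-! ### Comparison of volumes in a large ball -/

open WaveletSet in
theorem theorem5p1 {n : ℕ} (A : Matrix (Fin n) (Fin n) ℝ) (hA : 1 < |A.det|)
    (Γ : Submodule ℤ (EuclideanSpace ℝ (Fin n))) [DiscreteTopology Γ] [IsZLattice ℝ Γ]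
    (hΛ : ∃ Λ : Submodule ℤ (EuclideanSpace ℝ (Fin n)), Λ ≤ Γ ∧
      Tendsto
        (fun j : ℕ => WaveletSet.sectionVolume
          (Submodule.span ℝ (Λ : Set (EuclideanSpace ℝ (Fin n))))
          (WaveletSet.act (A ^ (-(j : ℤ))) '' Metric.ball 0 1))
        atTop (𝓝 ∞)) :
    ¬ ∃ W : Set (EuclideanSpace ℝ (Fin n)), WaveletSet.IsWaveletSet A Γ W := by
  rintro ⟨W, hW, ⟨-, hdil⟩, ⟨hpack, -⟩⟩
  obtain ⟨Λ, hΛΓ, hlim⟩ := hΛ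
  have hA0 : A.det ≠ 0 := fun h => by simp [h] at hA; linarith
  have hbasis := exists_basis_span_mem Λ
  generalize Submodule.span ℝ (Λ : Set (EuclideanSpace ℝ (Fin n))) = V at hlim hbasis
  obtain ⟨ι, _, b, hb⟩ := hbasis
  obtain ⟨F, N, hN, hFN, hsum, hpos⟩ := exists_factorization_summable hA0 V b hlim
  obtain ⟨K, hK, hcov⟩ :=
    exists_covering_set (volume : Measure (EuclideanSpace ℝ (Fin n))) V b
  have hWfin := volume_ne_top_of_packs Γ hW hpack
  have hmn : Module.finrank ℝ Vᗮ < n := by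
    have := V.finrank_add_finrank_orthogonal
    rw [finrank_euclideanSpace_fin] at this
    omega
  let β := (volume (Metric.ball (0 : EuclideanSpace ℝ (Fin n)) 1)).toReal
  have hβfin : volume (Metric.ball (0 : EuclideanSpace ℝ (Fin n)) 1) ≠ ∞ := measure_ball_lt_top.ne
  have hβ : 0 < β := ENNReal.toReal_pos (Metric.measure_ball_pos volume _ one_pos).ne' hβfin
  have hgeo : Summable fun k : ℕ => (|A.det| ^ k)⁻¹ := by
    simp_rw [← inv_pow]
    exact summable_geometric_of_lt_one (by positivity) (inv_lt_one_of_one_lt₀ hA)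
  have houter : ∀ k : ℕ, volume {x | act (A ^ k) x ∈ W}
      = ENNReal.ofReal ((|A.det| ^ k)⁻¹ * (volume W).toReal) := by
    intro k
    rw [volume_preimage_act (by rw [Matrix.det_pow]; exact pow_ne_zero k hA0), Matrix.det_pow,
      abs_pow, ENNReal.ofReal_mul (by positivity), ENNReal.ofReal_toReal hWfin]
  let f : Submodule.span ℤ (Set.range b) → Γ := fun γ => ⟨(γ : V), hΛΓ (hb _ γ.2)⟩
  have hf : Function.Injective f := fun γ γ' h => by
    have h' : ((γ : V) : EuclideanSpace ℝ (Fin n)) = (γ' : V) := 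
      congrArg (Subtype.val : Γ → _) h
    exact Subtype.ext (Subtype.ext h')
  have hinner : ∀ (k : ℕ) (R : ℝ), 0 < R →
      volume ({x | act (A ^ (-(k : ℤ))) x ∈ W} ∩ Metric.ball 0 R)
        ≤ ENNReal.ofReal (|LinearMap.det (N k)| * (R ^ Module.finrank ℝ Vᗮ * K)) := by
    intro k R hR
    obtain ⟨Q, hQ, hQcov⟩ := hcov (F k) (N k) (hN k) R hR
    rw [← mul_assoc]
    refine le_trans ?_ hQ
    have : Countable (Submodule.span ℤ (Set.range b)) := hf.countable
    refine measure_inter_le_of_packs volume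
      (fun γ : Submodule.span ℤ (Set.range b) => act (A ^ k) (f γ : EuclideanSpace ℝ (Fin n)))
      (hW.preimage (quasiMeasurePreserving_act ?_)) (packs_dilate hA0 Γ hpack f hf k)
      fun x hx => ?_
    · rw [Matrix.zpow_neg_natCast, Matrix.det_nonsing_inv, Matrix.det_pow]
      simp [hA0]
    · obtain ⟨γ, hγ⟩ := hQcov x hx
      exact ⟨γ, by rw [← hFN] at hγ; exact hγ⟩
  have hmain : ∀ R : ℝ, 0 < R → R ^ n * β ≤ (∑' k : ℕ, (|A.det| ^ k)⁻¹) * (volume W).toReal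
      + R ^ Module.finrank ℝ Vᗮ * (K * ∑' k, |LinearMap.det (N k)|) := by
    intro R hR
    have h1 : volume (Metric.ball (0 : EuclideanSpace ℝ (Fin n)) R)
        ≤ ∑' k : ℕ, volume {x | act (A ^ k) x ∈ W}
          + ∑' k : ℕ, volume ({x | act (A ^ (-(k : ℤ))) x ∈ W} ∩ Metric.ball 0 R) := by
      refine le_trans (measure_mono_ae ?_) ((measure_union_le
        (⋃ k : ℕ, {x | act (A ^ k) x ∈ W})
        (⋃ k : ℕ, {x | act (A ^ (-(k : ℤ))) x ∈ W} ∩ Metric.ball 0 R)).trans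
        (add_le_add (measure_iUnion_le _) (measure_iUnion_le _)))
      filter_upwards [hdil] with x hx hxR
      obtain ⟨j, hj⟩ := exists_int_act_mem hx
      -- The exponent `0` lies in both families, which is harmless for an upper bound.
      obtain ⟨k, rfl | rfl⟩ := j.eq_nat_or_neg
      · exact Or.inl (Set.mem_iUnion.2 ⟨k, by simpa using hj⟩)
      · exact Or.inr (Set.mem_iUnion.2 ⟨k, hj, hxR⟩)
    have h2 : ∑' k : ℕ, volume ({x | act (A ^ (-(k : ℤ))) x ∈ W} ∩ Metric.ball 0 R)
        ≤ ENNReal.ofReal ((∑' k, |LinearMap.det (N k)|) * (R ^ Module.finrank ℝ Vᗮ * K)) := by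
      rw [← tsum_mul_right,
        ENNReal.ofReal_tsum_of_nonneg (fun k => by positivity) (hsum.mul_right _)]
      exact ENNReal.tsum_le_tsum fun k => hinner k R hR
    simp_rw [houter] at h1
    rw [← ENNReal.ofReal_tsum_of_nonneg (fun k => by positivity) (hgeo.mul_right _),
      tsum_mul_right, Measure.addHaar_ball_of_pos _ _ hR, finrank_euclideanSpace_fin,
      ← ENNReal.ofReal_toReal hβfin, ← ENNReal.ofReal_mul (by positivity)] at h1
    have h3 := h1.trans (add_le_add_right h2 _)
    rw [← ENNReal.ofReal_add (by positivity) (by positivity),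
      ENNReal.ofReal_le_ofReal_iff (by positivity)] at h3
    linarith
  obtain ⟨R, hR, hlt⟩ := exists_real_pow_gt hβ
    (C := (∑' k : ℕ, (|A.det| ^ k)⁻¹) * (volume W).toReal) (by positivity)
    (D := K * ∑' k, |LinearMap.det (N k)|) (by positivity) hmn
  exact absurd (hmain R hR) (not_le.2 hlt)
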